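/- Let $B_m$ denote the Bernoulli numbers, and put $\lambda_m = \frac{8^m(2^m-1)B_m^2}{2(m!)^2}$ for even $m\ge 2$ and $\lambda_m=0$ for odd $m$. There is exactly one probability distribution $W$ on $\mathbb{R}$ with moment generating function $$E\left[e^{zW}\right]=\exp\left(\sum_{m=1}^{\infty}\frac{\lambda_m}{m}z^m\right)\qquad\text{for real } |z|<\frac{\pi^2}{4},$$ where the expectation is finite and the series converges, and this distribution has the following properties. 1. For every $t\in\mathbb{R}$, the characteristic function of $W$ is $\varphi_W(t)=E[e^{itW}]=\prod_{n=1}^{\infty}\operatorname{sech}\left(\frac{2t}{\pi n}\right)$. 2. If $A_1,A_2,\dots$ are iid random variables with density $\frac1\pi\operatorname{sech}x$, then the series $\frac{4}{\pi^2}\sum_{n=1}^{\infty}\frac{A_n}{n}$ converges almost surely, and its sum has the distribution $W$. 3. $W$ is absolutely continuous with respect to Lebesgue measure. 4. If $L_{mn}$ ($n\ge 1$, and $m\ge 1$ odd) are iid Laplace random variables, with density $\frac12e^{-|x|}$, then the iterated series $\frac{4}{\pi^2}\sum_{n=1}^{\infty}\ \sum_{m\ge 1,\ m\text{ odd}}\frac{L_{mn}}{mn}$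 converges almost surely (almost surely all inner series over $m$ converge, and so does the outer series over $n$), and its sum has the distribution $W$. 5. $W$ is infinitely divisible: for every $n\ge 1$ there exist iid random variables $X_1,\dots,X_n$ such that $X_1+\cdots+X_n$ has the distribution $W$. -/

import Mathlib

open MeasureTheory ProbabilityTheory Filter Topology

/-- The cycle weights `λ_m = 8^m (2^m - 1) B_m² / (2 (m!)²)` for even `m`, and `λ_m = 0` for
odd `m`, where `B_m` is the `m`-th Bernoulli number. -/
noncomputable def writheLambda (m : ℕ) : ℝ :=
  if Even m then
    (8 : ℝ) ^ m * ((2 : ℝ) ^ m - 1) * ((bernoulli m : ℚ) : ℝ) ^ 2 / (2 * (m.factorial : ℝ) ^ 2)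
  else 0

/-- `W` is the law with moment generating function
`E[exp (z W)] = exp (∑ m, (λ_m / m) z ^ m)`, for `z` in the interval of convergence
`|z| < π² / 4` of the power series. The term at `m = 0` is zero. -/
def HasWritheMGF (W : ProbabilityMeasure ℝ) : Prop :=
  ∀ z : ℝ, |z| < Real.pi ^ 2 / 4 →
    Integrable (fun x : ℝ => Real.exp (z * x)) (W : Measure ℝ) ∧
    Summable (fun m : ℕ => writheLambda m / m * z ^ m) ∧
    ∫ x, Real.exp (z * x) ∂(W : Measure ℝ) =
      Real.exp (∑' m : ℕ, writheLambda m / m * z ^ m)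

/-- The hyperbolic secant. -/
noncomputable def sech (x : ℝ) : ℝ := 1 / Real.cosh x

/-- The law on `ℝ` with density `(1/π) sech x`. -/
noncomputable def sechLaw : Measure ℝ :=
  volume.withDensity (fun x => ENNReal.ofReal (1 / Real.pi * sech x))

/-- The standard Laplace law on `ℝ`, with density `(1/2) exp (-|x|)`. -/
noncomputable def laplaceLaw : Measure ℝ :=
  volume.withDensity (fun x => ENNReal.ofReal (1 / 2 * Real.exp (-|x|)))

/-- A law `μ` on `ℝ` is infinitely divisible if for every `n ≥ 1` there are iid random variables
`X_1, …, X_n` whose sum has law `μ`. -/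
def IsInfinitelyDivisible (μ : Measure ℝ) : Prop :=
  ∀ n : ℕ, 1 ≤ n →
    ∃ (Ω : Type) (_ : MeasurableSpace Ω) (P : Measure Ω) (X : Fin n → Ω → ℝ),
      IsProbabilityMeasure P ∧
      iIndepFun X P ∧
      (∀ i j, IdentDistrib (X i) (X j) P P) ∧
      HasLaw (fun ω => ∑ i, X i ω) μ P

/-! Every law is identified through its moment generating function near the origin, which determines
it by analytic continuation to a vertical strip (`HasMGFOn.measure_eq`). The secant density has
transform sec(πs/2), by Euler's beta integral and the reflection formula. So ∑ A_n/n should have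
transform ∏ sec(πs/(2n)). Expanding each log sec through Euler's cosine product gives a positive
triple series in n, in the odd integer 2k+1 and in the exponent. Summed over n and k first, it
produces ζ(m)·(1-2^{-m})ζ(m) for even m, hence the squared Bernoulli numbers in λ_m
(`hasSum_log_cos_writhe`). The scale factor 4/π² carries |s| < 1 to |z| < π²/4.

The probabilistic engine is `exists_weighted_series_limit`: partial sums of centred independent
terms form an L¹-bounded martingale, so they converge almost surely, and uniform integrability
passes the transforms to the limit. Applied to secant variables it gives existence, the
characteristic function and the first series. Applied to Laplace variables with weights 1/(2k+1) it
rebuilds a secant variable, because (1-s²)⁻¹ is the Laplace transform factor in Euler's product.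
Absolute continuity comes from one secant summand that convolves with the rest. For infinite
divisibility the Laplace law is replaced by a symmetrized gamma law, whose transform is (1-s²)^{-a}.
-/

/-! ### Moment generating functions near the origin -/

/-- `μ` has moment generating function `M` on the interval `(-r, r)`. -/
def HasMGFOn (μ : Measure ℝ) (r : ℝ) (M : ℝ → ℝ) : Prop :=
  ∀ s : ℝ, |s| < r →
    Integrable (fun x : ℝ => Real.exp (s * x)) μ ∧ ∫ x, Real.exp (s * x) ∂μ = M s

namespace HasMGFOn

variable {μ ν : Measure ℝ} {r : ℝ} {M N : ℝ → ℝ}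

lemma congr (h : HasMGFOn μ r M) (hMN : ∀ s, |s| < r → M s = N s) : HasMGFOn μ r N :=
  fun s hs => ⟨(h s hs).1, (h s hs).2.trans (hMN s hs)⟩

lemma mem_interior (h : HasMGFOn μ r M) {s : ℝ} (hs : |s| < r) :
    s ∈ interior (integrableExpSet id μ) := by
  refine _root_.mem_interior.2 ⟨{x | |x| < r}, fun x hx => (h x hx).1, ?_, hs⟩
  exact isOpen_lt continuous_abs continuous_const

lemma mgf_eq (h : HasMGFOn μ r M) {s : ℝ} (hs : |s| < r) : mgf id μ s = M s := (h s hs).2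

/-- Two probability measures whose moment generating functions agree near the origin coincide. -/
theorem measure_eq [IsFiniteMeasure μ] [IsFiniteMeasure ν] (hr : 0 < r)
    (hμ : HasMGFOn μ r M) (hν : HasMGFOn ν r M) : μ = ν := by
  have hstrip : ∀ ξ : Measure ℝ, HasMGFOn ξ r M →
      AnalyticOnNhd ℂ (complexMGF id ξ) {z | |z.re| < r} := fun ξ hξ =>
    analyticOnNhd_complexMGF.mono fun z hz => hξ.mem_interior hz
  have hconn : IsPreconnected {z : ℂ | |z.re| < r} := by
    have : {z : ℂ | |z.re| < r} = Complex.reLm ⁻¹' Set.Ioo (-r) r := by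
      ext z; simp [abs_lt]
    rw [this]
    exact ((convex_Ioo (-r) r).linear_preimage Complex.reLm).isPreconnected
  -- The real points near 0, where the two transforms agree, accumulate at 0; the identity theorem
  -- then covers the whole strip, including the imaginary axis.
  have hfreq : ∃ᶠ z : ℂ in 𝓝[≠] 0, complexMGF id μ z = complexMGF id ν z := by
    have hreal : ∀ᶠ x : ℝ in 𝓝[≠] 0, complexMGF id μ x = complexMGF id ν x := by
      have : ∀ᶠ x : ℝ in 𝓝 0, |x| < r :=
        (isOpen_lt continuous_abs continuous_const).mem_nhds (by simpa using hr)
      filter_upwards [this.filter_mono nhdsWithin_le_nhds] with x hx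
      rw [complexMGF_ofReal, complexMGF_ofReal, hμ.mgf_eq hx, hν.mgf_eq hx]
    have htend : Tendsto (fun x : ℝ => (x : ℂ)) (𝓝[≠] 0) (𝓝[≠] 0) := by
      refine tendsto_nhdsWithin_iff.2 ⟨?_, ?_⟩
      · exact (Complex.continuous_ofReal.tendsto' 0 0 (by simp)).mono_left nhdsWithin_le_nhds
      · filter_upwards [self_mem_nhdsWithin] with x hx
        simpa using hx
    exact htend.frequently hreal.frequently
  have heq := AnalyticOnNhd.eqOn_of_preconnected_of_frequently_eq (hstrip μ hμ) (hstrip ν hν)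
    hconn (by simpa using hr) hfreq
  refine Measure.ext_of_charFun (funext fun t => ?_)
  rw [← complexMGF_id_mul_I, ← complexMGF_id_mul_I]
  exact heq (by simpa using hr)

/-- Stating the radius condition as a product allows `c = 0` and lets all the terms of a weighted
series share one radius `ρ`. -/
lemma map_const_mul (h : HasMGFOn μ r M) (hr : 0 < r) {c ρ : ℝ} (hc : |c| * ρ ≤ r) :
    HasMGFOn (μ.map (fun x => c * x)) ρ (fun s => M (c * s)) := by
  intro s hs
  have hcs : |c * s| < r := by
    rcases eq_or_ne c 0 with rfl | hc0
    · simpa using hr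
    · rw [abs_mul]
      exact (mul_lt_mul_of_pos_left hs (abs_pos.2 hc0)).trans_le hc
  have hm : Measurable fun x : ℝ => c * x := measurable_const_mul c
  have hfun : (fun x : ℝ => Real.exp (s * (c * x))) = fun x => Real.exp (c * s * x) := by
    ext x; ring_nf
  constructor
  · rw [integrable_map_measure (by fun_prop) hm.aemeasurable]
    exact (h _ hcs).1.congr (.of_forall fun x => (congrFun hfun x).symm)
  · rw [integral_map hm.aemeasurable (by fun_prop), hfun]
    exact (h _ hcs).2

lemma conv [SFinite μ] [SFinite ν] (hμ : HasMGFOn μ r M) (hν : HasMGFOn ν r N) :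
    HasMGFOn (μ ∗ ν) r (fun s => M s * N s) := by
  intro s hs
  have hm : Measurable fun p : ℝ × ℝ => p.1 + p.2 := measurable_fst.add measurable_snd
  have hfun : (fun p : ℝ × ℝ => Real.exp (s * (p.1 + p.2)))
      = fun p => Real.exp (s * p.1) * Real.exp (s * p.2) := by
    ext p; rw [mul_add, Real.exp_add]
  rw [Measure.conv]
  constructor
  · rw [integrable_map_measure (by fun_prop) hm.aemeasurable]
    exact ((hμ s hs).1.mul_prod (hν s hs).1).congr (.of_forall fun p => (congrFun hfun p).symm)
  · rw [integral_map hm.aemeasurable (by fun_prop), hfun, integral_prod_mul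
      (fun x => Real.exp (s * x)) (fun x => Real.exp (s * x)), (hμ s hs).2, (hν s hs).2]

lemma integrable_id (h : HasMGFOn μ r M) (hr : 0 < r) : Integrable (fun x : ℝ => x) μ := by
  simpa using integrable_pow_of_mem_interior_integrableExpSet
    (h.mem_interior (s := 0) (by simpa using hr)) 1

/-- The mean is the derivative of the transform at 0, and an even function has derivative 0 there.
-/
lemma integral_id_eq_zero (h : HasMGFOn μ r M) (hr : 0 < r) (heven : ∀ s, M (-s) = M s) :
    ∫ x, x ∂μ = 0 := by
  have h0 := h.mem_interior (s := 0) (by simpa using hr)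
  have hd := (hasDerivAt_mgf h0).differentiableAt
  have hev : (fun s => mgf id μ (-s)) =ᶠ[𝓝 0] mgf id μ := by
    have : ∀ᶠ x : ℝ in 𝓝 0, |x| < r :=
      (isOpen_lt continuous_abs continuous_const).mem_nhds (by simpa using hr)
    filter_upwards [this] with x hx
    rw [h.mgf_eq hx, h.mgf_eq (by simpa using hx), heven]
  have := hev.deriv_eq
  rw [deriv_comp_neg, neg_zero, deriv_mgf_zero h0] at this
  simp only [id] at this
  linarith

lemma isProbabilityMeasure (h : HasMGFOn μ r M) (hr : 0 < r) (hM : M 0 = 1) :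
    IsProbabilityMeasure μ := by
  obtain ⟨h1, h2⟩ := h 0 (by simpa using hr)
  have hfin : IsFiniteMeasure μ := by simpa [integrable_const_iff] using h1
  refine ⟨?_⟩
  simp only [zero_mul, Real.exp_zero, integral_const, smul_eq_mul, mul_one, hM] at h2
  exact (ENNReal.toReal_eq_one_iff _).1 h2

/-- From s|x| ≤ exp(sx) + exp(-sx). This supplies the L¹ bound for martingale convergence. -/
lemma integral_abs_le (h : HasMGFOn μ r M) {s : ℝ} (hs0 : 0 < s) (hs : s < r) :
    ∫ x, |x| ∂μ ≤ (M s + M (-s)) / s := by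
  have h1 := h s (by rwa [abs_of_pos hs0])
  have h2 := h (-s) (by rwa [abs_neg, abs_of_pos hs0])
  rw [← h1.2, ← h2.2, ← integral_add h1.1 h2.1, ← integral_div]
  refine integral_mono (h.integrable_id (hs0.trans hs)).abs ((h1.1.add h2.1).div_const s)
    fun x => ?_
  change |x| ≤ (Real.exp (s * x) + Real.exp (-s * x)) / s
  rw [le_div_iff₀ hs0]
  have hA := Real.add_one_le_exp (s * x)
  have hB := Real.add_one_le_exp (-s * x)
  have hC := Real.exp_pos (s * x)
  have hD := Real.exp_pos (-s * x)
  rcases abs_cases x with ⟨hx, -⟩ | ⟨hx, -⟩ <;> rw [hx] <;> linarith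

end HasMGFOn

/-! ### Almost sure limits and series of independent variables -/

/-- Convergent moment generating functions pass to almost sure limits, by uniform integrability. -/
theorem hasMGFOn_of_ae_tendsto {Ω : Type*} [MeasurableSpace Ω] {P : Measure Ω}
    [IsProbabilityMeasure P] {X : ℕ → Ω → ℝ} {S : Ω → ℝ} (hX : ∀ n, AEMeasurable (X n) P)
    (hS : AEMeasurable S P) (hlim : ∀ᵐ ω ∂P, Tendsto (fun n => X n ω) atTop (𝓝 (S ω)))
    {ρ : ℝ} {M : ℕ → ℝ → ℝ} {G : ℝ → ℝ} (hM : ∀ n, HasMGFOn (P.map (X n)) ρ (M n))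
    (hG : ∀ s, |s| < ρ → Tendsto (fun n => M n s) atTop (𝓝 (G s))) :
    HasMGFOn (P.map S) ρ G := by
  have hXM : ∀ n s, |s| < ρ → Integrable (fun ω => Real.exp (s * X n ω)) P ∧
      ∫ ω, Real.exp (s * X n ω) ∂P = M n s := by
    intro n s hs
    have := hM n s hs
    rwa [integrable_map_measure (by fun_prop) (hX n),
      integral_map (hX n) (by fun_prop)] at this
  intro s hs
  -- Since the interval is open, there is room for an exponent p > 1: the variables exp(sX_n) are
  -- bounded in Lᵖ, hence uniformly integrable.
  obtain ⟨p, hp1, hps⟩ : ∃ p : ℝ, 1 < p ∧ |p * s| < ρ := by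
    have : ∀ᶠ p : ℝ in 𝓝[>] 1, |p * s| < ρ := by
      have hopen : IsOpen {p : ℝ | |p * s| < ρ} := isOpen_lt (by fun_prop) continuous_const
      have hmem : ∀ᶠ p : ℝ in 𝓝 1, |p * s| < ρ := hopen.mem_nhds (by simpa using hs)
      exact hmem.filter_mono nhdsWithin_le_nhds
    obtain ⟨p, hp⟩ := (this.and self_mem_nhdsWithin).exists
    exact ⟨p, hp.2, hp.1⟩
  obtain ⟨B, hB⟩ := (hG _ hps).bddAbove_range
  have hB' : ∀ n, ∫ ω, Real.exp (p * s * X n ω) ∂P ≤ B := fun n => by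
    rw [(hXM n _ hps).2]; exact hB ⟨n, rfl⟩
  have hB0 : 0 ≤ B := (integral_nonneg fun ω => (Real.exp_pos _).le).trans (hB' 0)
  have hmeas : ∀ n, AEStronglyMeasurable (fun ω => Real.exp (s * X n ω)) P :=
    fun n => (hXM n s hs).1.aestronglyMeasurable
  have hui : UnifIntegrable (fun n ω => Real.exp (s * X n ω)) 1 P := by
    refine unifIntegrable_of le_rfl ENNReal.one_ne_top hmeas fun ε hε => ?_
    obtain ⟨K, hK1, hK⟩ : ∃ K : ℝ, 1 ≤ K ∧ B / K ^ (p - 1) ≤ ε := by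
      have : Tendsto (fun K : ℝ => B / K ^ (p - 1)) atTop (𝓝 0) :=
        (tendsto_rpow_atTop (by linarith)).const_div_atTop B
      obtain ⟨K, h1, h2⟩ := ((this.eventually (ge_mem_nhds hε)).and (eventually_ge_atTop 1)).exists
      exact ⟨K, h2, h1⟩
    have hK0 : 0 < K := by linarith
    refine ⟨K.toNNReal, fun n => ?_⟩
    -- Where exp(sX) ≥ K, one has exp(sX) ≤ exp(psX) / K^(p-1).
    calc eLpNorm _ 1 P
        ≤ eLpNorm (fun ω => Real.exp (p * s * X n ω) / K ^ (p - 1)) 1 P := by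
          refine eLpNorm_mono fun ω => ?_
          rw [Real.norm_of_nonneg (by positivity : 0 ≤ Real.exp (p * s * X n ω) / K ^ (p - 1))]
          by_cases hω : K.toNNReal ≤ ‖Real.exp (s * X n ω)‖₊
          · rw [Set.indicator_of_mem (by exact hω), Real.norm_of_nonneg (Real.exp_pos _).le,
              le_div_iff₀ (by positivity)]
            have hKe : K ≤ Real.exp (s * X n ω) := by
              have := NNReal.coe_le_coe.2 hω
              rwa [Real.coe_toNNReal _ hK0.le, coe_nnnorm,
                Real.norm_of_nonneg (Real.exp_pos _).le] at this
            calc Real.exp (s * X n ω) * K ^ (p - 1)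
                ≤ Real.exp (s * X n ω) * Real.exp (s * X n ω) ^ (p - 1) := by
                  gcongr
              _ = Real.exp (p * s * X n ω) := by
                  rw [← Real.exp_mul, ← Real.exp_add]; ring_nf
          · rw [Set.indicator_of_notMem (by exact hω), norm_zero]
            positivity
      _ = ENNReal.ofReal (∫ ω, Real.exp (p * s * X n ω) / K ^ (p - 1) ∂P) := by
          rw [eLpNorm_one_eq_lintegral_enorm, ← ofReal_integral_norm_eq_lintegral_enorm
            ((hXM n _ hps).1.div_const _)]
          congr 1
          refine integral_congr_ae (.of_forall fun ω => ?_)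
          exact Real.norm_of_nonneg (by positivity)
      _ ≤ ENNReal.ofReal ε := by
          refine ENNReal.ofReal_le_ofReal (le_trans ?_ hK)
          rw [integral_div]
          gcongr
          exact hB' n
  have hae : ∀ᵐ ω ∂P, Tendsto (fun n => Real.exp (s * X n ω)) atTop (𝓝 (Real.exp (s * S ω))) := by
    filter_upwards [hlim] with ω hω
    exact (Real.continuous_exp.tendsto _).comp (hω.const_mul s)
  obtain ⟨C, hC⟩ := (hG s hs).bddAbove_range
  have hUI : UniformIntegrable (fun n ω => Real.exp (s * X n ω)) 1 P := by
    refine ⟨hmeas, hui, C.toNNReal, fun n => ?_⟩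
    rw [eLpNorm_one_eq_lintegral_enorm, ← ofReal_integral_norm_eq_lintegral_enorm (hXM n s hs).1]
    refine ENNReal.ofReal_le_ofReal ?_
    simp only [Real.norm_eq_abs, Real.abs_exp]
    rw [(hXM n s hs).2]
    exact hC ⟨n, rfl⟩
  have hint := hUI.integrable_of_ae_tendsto hae
  have htend := tendsto_integral_of_L1' _ hint.aestronglyMeasurable
    (.of_forall fun n => (hXM n s hs).1) (tendsto_Lp_finite_of_tendsto_ae le_rfl
      ENNReal.one_ne_top hmeas (memLp_one_iff_integrable.2 hint) hui hae)
  simp only [(hXM _ s hs).2] at htend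
  rw [integrable_map_measure (by fun_prop) hS, integral_map hS (by fun_prop)]
  exact ⟨hint, tendsto_nhds_unique htend (hG s hs)⟩

/-- Partial sums of independent variables with moment generating functions. -/
lemma hasMGFOn_map_sum {Ω ι : Type*} [MeasurableSpace Ω] {P : Measure Ω} [IsProbabilityMeasure P]
    {Y : ι → Ω → ℝ} (hY : iIndepFun Y P) (hm : ∀ n, Measurable (Y n)) {ρ : ℝ} {M : ι → ℝ → ℝ}
    (hM : ∀ n, HasMGFOn (P.map (Y n)) ρ (M n)) (s : Finset ι) :
    HasMGFOn (P.map (fun ω => ∑ n ∈ s, Y n ω)) ρ (fun z => ∏ n ∈ s, M n z) := by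
  intro z hz
  have hYM : ∀ n, Integrable (fun ω => Real.exp (z * Y n ω)) P ∧ mgf (Y n) P z = M n z := by
    intro n
    have := hM n z hz
    rwa [integrable_map_measure (by fun_prop) (hm n).aemeasurable,
      integral_map (hm n).aemeasurable (by fun_prop)] at this
  have hsm : AEMeasurable (fun ω => ∑ n ∈ s, Y n ω) P := by fun_prop
  rw [integrable_map_measure (by fun_prop) hsm, integral_map hsm (by fun_prop)]
  have h1 := hY.integrable_exp_mul_sum hm (s := s) fun i _ => (hYM i).1
  have h2 := hY.mgf_sum hm s (t := z)
  simp only [mgf, Finset.sum_apply] at h1 h2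
  refine ⟨h1, h2.trans (Finset.prod_congr rfl fun i _ => (hYM i).2)⟩

/-- A series of independent centred variables whose partial sums have convergent moment generating
functions converges almost surely. -/
lemma ae_exists_tendsto_sum {Ω : Type*} [MeasurableSpace Ω] {P : Measure Ω}
    [IsProbabilityMeasure P] {Y : ℕ → Ω → ℝ} (hY : iIndepFun Y P) (hm : ∀ n, Measurable (Y n))
    (hmean : ∀ n, ∫ ω, Y n ω ∂P = 0) {ρ : ℝ} (hρ : 0 < ρ) {M : ℕ → ℝ → ℝ}
    (hM : ∀ n, HasMGFOn (P.map (Y n)) ρ (M n)) {G : ℝ → ℝ}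
    (hG : ∀ s, |s| < ρ → Tendsto (fun N => ∏ n ∈ Finset.range N, M n s) atTop (𝓝 (G s))) :
    ∀ᵐ ω ∂P, ∃ l, Tendsto (fun N => ∑ n ∈ Finset.range N, Y n ω) atTop (𝓝 l) := by
  have hsm : ∀ n, StronglyMeasurable (Y n) := fun n => (hm n).stronglyMeasurable
  have hYint : ∀ n, Integrable (Y n) P := fun n =>
    (integrable_map_measure (by fun_prop) (hm n).aemeasurable).1 ((hM n).integrable_id hρ)
  let ℱ := Filtration.natural Y hsm
  -- The sum has n + 1 terms, so that `f n` uses exactly the variables up to index n, those known to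
  -- `ℱ n`.
  let f : ℕ → Ω → ℝ := fun n ω => ∑ i ∈ Finset.range (n + 1), Y i ω
  have hfint : ∀ n, Integrable (f n) P := fun n => integrable_finsetSum _ fun i _ => hYint i
  have hadp : StronglyAdapted ℱ f := fun n => by
    refine Finset.stronglyMeasurable_fun_sum _ fun i hi => ?_
    exact (Filtration.stronglyAdapted_natural hsm i).mono
      (ℱ.mono (Nat.lt_succ_iff.1 (Finset.mem_range.1 hi)))
  have hmart : Martingale f ℱ P := by
    refine martingale_nat hadp hfint fun n => ?_
    have hfs : f (n + 1) = f n + Y (n + 1) := by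
      ext ω; exact Finset.sum_range_succ _ _
    have h1 : P[f n | ℱ n] = f n := condExp_of_stronglyMeasurable (ℱ.le n) (hadp n) (hfint n)
    have h2 := hY.condExp_natural_ae_eq_of_lt hsm (Nat.lt_succ_self n)
    rw [hfs]
    filter_upwards [condExp_add (hfint n) (hYint (n + 1)) (ℱ n), h2] with ω hω hω2
    rw [hω, Pi.add_apply, h1]
    have : (P[Y (n + 1) | ℱ n]) ω = 0 := hω2.trans (hmean _)
    rw [this, add_zero]
  have hρ2 : 0 < ρ / 2 := by linarith
  have hlt : ρ / 2 < ρ := by linarith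
  obtain ⟨B, hB⟩ := (((hG (ρ / 2) (by rwa [abs_of_pos hρ2])).add
    (hG (-(ρ / 2)) (by rwa [abs_neg, abs_of_pos hρ2]))).div_const (ρ / 2)).bddAbove_range
  have hbdd : ∀ n, eLpNorm (f n) 1 P ≤ B.toNNReal := fun n => by
    rw [eLpNorm_one_eq_lintegral_enorm, ← ofReal_integral_norm_eq_lintegral_enorm (hfint n)]
    refine ENNReal.ofReal_le_ofReal ?_
    have h := (hasMGFOn_map_sum hY hm hM (Finset.range (n + 1))).integral_abs_le hρ2 hlt
    rw [integral_map (by fun_prop) (by fun_prop)] at h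
    exact h.trans (hB ⟨n + 1, rfl⟩)
  filter_upwards [hmart.submartingale.exists_ae_tendsto_of_bdd hbdd] with ω ⟨l, hl⟩
  exact ⟨l, (tendsto_add_atTop_iff_nat 1).1 hl⟩

/-- Characteristic functions of almost surely convergent variables converge. -/
lemma tendsto_charFun_of_ae_tendsto {Ω : Type*} [MeasurableSpace Ω] {P : Measure Ω}
    [IsProbabilityMeasure P] {X : ℕ → Ω → ℝ} {S : Ω → ℝ} (hX : ∀ n, AEMeasurable (X n) P)
    (hS : AEMeasurable S P) (hlim : ∀ᵐ ω ∂P, Tendsto (fun n => X n ω) atTop (𝓝 (S ω))) (t : ℝ) :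
    Tendsto (fun n => charFun (P.map (X n)) t) atTop (𝓝 (charFun (P.map S) t)) := by
  have h : ∀ Z : Ω → ℝ, AEMeasurable Z P →
      charFun (P.map Z) t = ∫ ω, Complex.exp (t * Z ω * Complex.I) ∂P := fun Z hZ => by
    rw [charFun_apply_real, integral_map hZ (by fun_prop)]
  simp only [h _ (hX _), h S hS]
  refine tendsto_integral_of_dominated_convergence (fun _ => 1) (fun n => ?_)
    (integrable_const 1) (fun n => .of_forall fun ω => ?_) ?_
  · have := hX n
    fun_prop
  · rw [← Complex.ofReal_mul, Complex.norm_exp_ofReal_mul_I]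
  · filter_upwards [hlim] with ω hω
    have : Continuous fun x : ℝ => Complex.exp (t * x * Complex.I) := by fun_prop
    exact (this.tendsto _).comp hω

/-- Weighted series `∑ c n * X n` of iid variables with a symmetric law. -/
theorem exists_weighted_series_limit {Ω : Type*} [MeasurableSpace Ω] {P : Measure Ω}
    [IsProbabilityMeasure P] {X : ℕ → Ω → ℝ} (hX : iIndepFun X P) {μ : Measure ℝ}
    (hlaw : ∀ n, HasLaw (X n) μ P) {r ρ : ℝ} (hr : 0 < r) (hρ : 0 < ρ) {M : ℝ → ℝ}
    (hM : HasMGFOn μ r M) (heven : ∀ s, M (-s) = M s) {c : ℕ → ℝ} (hc : ∀ n, |c n| * ρ ≤ r)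
    {G : ℝ → ℝ}
    (hG : ∀ s, |s| < ρ → Tendsto (fun N => ∏ n ∈ Finset.range N, M (c n * s)) atTop (𝓝 (G s))) :
    ∃ S : Ω → ℝ, Measurable S ∧
      (∀ᵐ ω ∂P, Tendsto (fun N => ∑ n ∈ Finset.range N, c n * X n ω) atTop (𝓝 (S ω))) ∧
      HasMGFOn (P.map S) ρ G ∧
      ∀ t, Tendsto (fun N => ∏ n ∈ Finset.range N, charFun μ (c n * t)) atTop
        (𝓝 (charFun (P.map S) t)) := by
  -- A law only gives almost everywhere measurability, while the natural filtration needs measurable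
  -- versions.
  let X' : ℕ → Ω → ℝ := fun n => (hlaw n).aemeasurable.mk
  have hX'm : ∀ n, Measurable (X' n) := fun n => (hlaw n).aemeasurable.measurable_mk
  have hXX' : ∀ n, X n =ᵐ[P] X' n := fun n => (hlaw n).aemeasurable.ae_eq_mk
  have hX'law : ∀ n, P.map (X' n) = μ := fun n => by
    rw [← Measure.map_congr (hXX' n), (hlaw n).map_eq]
  have hX'ind : iIndepFun X' P := hX.congr hXX'
  let Y : ℕ → Ω → ℝ := fun n ω => c n * X' n ω
  have hm : ∀ n, Measurable (Y n) := fun n => (hX'm n).const_mul _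
  have hY : iIndepFun Y P := hX'ind.comp (fun n x => c n * x) fun n => measurable_const_mul _
  have hYlaw : ∀ n, P.map (Y n) = μ.map (fun x => c n * x) := fun n => by
    rw [← hX'law n, Measure.map_map (measurable_const_mul _) (hX'm n)]
    rfl
  have hYM : ∀ n, HasMGFOn (P.map (Y n)) ρ (fun s => M (c n * s)) := fun n => by
    rw [hYlaw]
    exact hM.map_const_mul hr (hc n)
  have hmean : ∀ n, ∫ ω, Y n ω ∂P = 0 := fun n => by
    have := (hYM n).integral_id_eq_zero hρ fun s => by rw [mul_neg, heven]
    rwa [integral_map (hm n).aemeasurable (by fun_prop)] at this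
  have hsm : ∀ N, AEMeasurable (fun ω => ∑ n ∈ Finset.range N, Y n ω) P := fun N => by fun_prop
  obtain ⟨S, hS, hlim⟩ := measurable_limit_of_tendsto_metrizable_ae hsm
    (ae_exists_tendsto_sum hY hm hmean hρ hYM hG)
  refine ⟨S, hS, ?_, ?_, fun t => ?_⟩
  · filter_upwards [hlim, ae_all_iff.2 hXX'] with ω hω hω'
    simpa only [hω'] using hω
  · exact hasMGFOn_of_ae_tendsto hsm hS.aemeasurable hlim
      (fun N => hasMGFOn_map_sum hY hm hYM (Finset.range N)) hG
  · refine (tendsto_charFun_of_ae_tendsto hsm hS.aemeasurable hlim t).congr fun N => ?_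
    rw [iIndepFun.charFun_map_fun_finsetSum_eq_prod (fun i _ => (hm i).aemeasurable)
      (hY.restrict _), Finset.prod_apply]
    refine Finset.prod_congr rfl fun i _ => ?_
    rw [hYlaw, charFun_map_mul]

/-! ### The hyperbolic secant law -/

/-- The two-sided Laplace transform of the hyperbolic secant, an instance of Euler's beta
integral under the logistic substitution. -/
lemma integral_cexp_mul_sech {z : ℂ} (hz : |z.re| < 1) :
    Integrable (fun x : ℝ => Complex.exp (z * x) * (sech x : ℝ)) ∧
      ∫ x : ℝ, Complex.exp (z * x) * (sech x : ℝ) = Real.pi / Complex.cos (Real.pi / 2 * z) := by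
  obtain ⟨hz1, hz2⟩ := abs_lt.1 hz
  set u : ℂ := (1 + z) / 2 with hu
  set v : ℂ := (1 - z) / 2 with hv
  have hre : u.re = (1 + z.re) / 2 ∧ v.re = (1 - z.re) / 2 := by
    constructor <;> simp [hu, hv]
  have hu0 : 0 < u.re := by rw [hre.1]; linarith
  have hv0 : 0 < v.re := by rw [hre.2]; linarith
  -- The logistic map x ↦ 1/(1 + exp(-2x)), a bijection from ℝ onto (0, 1) with derivative `f'`.
  let f : ℝ → ℝ := fun x => Real.exp x / (2 * Real.cosh x)
  let f' : ℝ → ℝ := fun x => 1 / (2 * Real.cosh x ^ 2)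
  have hcosh : ∀ x, 0 < Real.cosh x := Real.cosh_pos
  have hf1 : ∀ x, 1 - f x = Real.exp (-x) / (2 * Real.cosh x) := fun x => by
    have := hcosh x
    simp only [f]
    rw [eq_div_iff (by positivity), sub_mul, div_mul_cancel₀ _ (by positivity), Real.cosh_eq]
    ring
  have hderiv : ∀ x ∈ Set.univ, HasDerivWithinAt f (f' x) Set.univ x := fun x _ => by
    have h := (Real.hasDerivAt_exp x).div ((Real.hasDerivAt_cosh x).const_mul 2)
      (by have := hcosh x; positivity)
    refine (h.congr_deriv ?_).hasDerivWithinAt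
    have hc := (hcosh x).ne'
    have h1 : Real.cosh x - Real.sinh x = Real.exp (-x) := Real.cosh_sub_sinh x
    have h2 : Real.exp x * Real.exp (-x) = 1 := by rw [← Real.exp_add]; simp
    simp only [f']
    rw [div_eq_div_iff (by positivity) (by positivity)]
    linear_combination 4 * Real.cosh x ^ 2 * Real.exp x * h1 + 4 * Real.cosh x ^ 2 * h2
  have hfpos : ∀ x, 0 < f x := fun x => by
    have := hcosh x
    positivity
  have hf1pos : ∀ x, 0 < 1 - f x := fun x => by
    have := hcosh x
    rw [hf1]
    positivity
  have hratio : ∀ x, f x / (1 - f x) = Real.exp (2 * x) := fun x => by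
    have := hcosh x
    rw [hf1]
    simp only [f]
    rw [div_div_div_cancel_right₀ (by positivity), ← Real.exp_sub]
    ring_nf
  have hinj : Set.InjOn f Set.univ := fun x _ y _ hxy => by
    have := hratio x
    rw [hxy, hratio y, Real.exp_eq_exp] at this
    linarith
  have himage : f '' Set.univ = Set.Ioo 0 1 := by
    ext y
    constructor
    · rintro ⟨x, -, rfl⟩
      exact ⟨hfpos x, by linarith [hf1pos x]⟩
    · rintro ⟨hy0, hy1⟩
      have hy1' : 0 < 1 - y := by linarith
      refine ⟨Real.log (y / (1 - y)) / 2, trivial, ?_⟩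
      have := hratio (Real.log (y / (1 - y)) / 2)
      rw [mul_div_cancel₀ _ two_ne_zero, Real.exp_log (by positivity),
        div_eq_div_iff (hf1pos _).ne' hy1'.ne'] at this
      linarith
  let g : ℝ → ℂ := fun x => (x : ℂ) ^ (u - 1) * (1 - x : ℂ) ^ (v - 1)
  have hg : ∀ x, |f' x| • g (f x) = Complex.exp (z * x) * (sech x : ℝ) := fun x => by
    have hc := hcosh x
    have hlog1 : Real.log (f x) = x - Real.log (2 * Real.cosh x) := by
      simp only [f]
      rw [Real.log_div (by positivity) (by positivity), Real.log_exp]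
    have hlog2 : Real.log (1 - f x) = -x - Real.log (2 * Real.cosh x) := by
      rw [hf1, Real.log_div (by positivity) (by positivity), Real.log_exp]
    have h1 : (1 - (f x : ℂ)) = ((1 - f x : ℝ) : ℂ) := by push_cast; rfl
    have h2 : g (f x) = Complex.exp (z * x) * ((2 * Real.cosh x : ℝ) : ℂ) := by
      simp only [g]
      rw [h1, Complex.cpow_def_of_ne_zero (by exact_mod_cast (hfpos x).ne'),
        Complex.cpow_def_of_ne_zero (by exact_mod_cast (hf1pos x).ne'),
        ← Complex.ofReal_log (hfpos x).le, ← Complex.ofReal_log (hf1pos x).le, hlog1, hlog2,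
        ← Complex.exp_add, ← Real.exp_log (show 0 < 2 * Real.cosh x by positivity),
        Complex.ofReal_exp, ← Complex.exp_add, Real.exp_log (by positivity)]
      congr 1
      push_cast
      rw [hu, hv]
      ring
    have h3 : |f' x| = f' x := abs_of_pos (by positivity)
    rw [h2, h3, Complex.real_smul, mul_left_comm, ← Complex.ofReal_mul]
    congr 2
    simp only [f', sech]
    field_simp
  have hbeta : IntegrableOn g (Set.Ioo 0 1) := by
    have := Complex.betaIntegral_convergent hu0 hv0
    rwa [intervalIntegrable_iff_integrableOn_Ioo_of_le zero_le_one] at this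
  have huv : u + v = 1 := by rw [hu, hv]; ring
  -- As u + v = 1, the beta integral is Γ(u)Γ(1-u) = π / sin(πu), and πu = πz/2 + π/2 turns the sine
  -- into a cosine.
  have hval : ∫ x in Set.Ioo 0 1, g x = Real.pi / Complex.cos (Real.pi / 2 * z) := by
    have := Complex.betaIntegral_eq_Gamma_mul_div u v hu0 hv0
    rw [Complex.betaIntegral, intervalIntegral.integral_of_le zero_le_one,
      integral_Ioc_eq_integral_Ioo, huv, Complex.Gamma_one, div_one,
      show v = 1 - u by rw [← huv]; ring, Complex.Gamma_mul_Gamma_one_sub] at this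
    rw [show (1 - u - 1) = v - 1 by rw [← huv]; ring] at this
    rw [this, show (Real.pi : ℂ) * u = Real.pi / 2 * z + Real.pi / 2 by rw [hu]; ring,
      Complex.sin_add_pi_div_two]
  rw [← himage] at hbeta hval
  rw [integrableOn_image_iff_integrableOn_abs_deriv_smul MeasurableSet.univ hderiv hinj,
    integrableOn_univ] at hbeta
  rw [integral_image_eq_integral_abs_deriv_smul MeasurableSet.univ hderiv hinj,
    Measure.restrict_univ] at hval
  simp only [hg] at hbeta hval
  exact ⟨hbeta, hval⟩

lemma sech_pos (x : ℝ) : 0 < sech x := one_div_pos.2 (Real.cosh_pos x)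

lemma continuous_sech : Continuous sech :=
  continuous_const.div Real.continuous_cosh fun x => (Real.cosh_pos x).ne'

lemma integrable_sechLaw_iff {E : Type*} [NormedAddCommGroup E] [NormedSpace ℝ E] {g : ℝ → E} :
    Integrable g sechLaw ↔ Integrable (fun x => (1 / Real.pi * sech x) • g x) := by
  have := continuous_sech.measurable
  rw [sechLaw, integrable_withDensity_iff_integrable_smul' (by fun_prop) (by simp)]
  refine integrable_congr (.of_forall fun x => ?_)
  simp only
  rw [ENNReal.toReal_ofReal (mul_nonneg (by positivity) (sech_pos x).le)]

lemma integral_sechLaw {E : Type*} [NormedAddCommGroup E] [NormedSpace ℝ E] (g : ℝ → E) :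
    ∫ x, g x ∂sechLaw = ∫ x, (1 / Real.pi * sech x) • g x := by
  have := continuous_sech.measurable
  rw [sechLaw, integral_withDensity_eq_integral_toReal_smul (by fun_prop) (by simp)]
  refine integral_congr_ae (.of_forall fun x => ?_)
  simp only
  rw [ENNReal.toReal_ofReal (mul_nonneg (by positivity) (sech_pos x).le)]

/-- The complex moment generating function of the hyperbolic secant law. -/
lemma integral_cexp_sechLaw {z : ℂ} (hz : |z.re| < 1) :
    Integrable (fun x : ℝ => Complex.exp (z * x)) sechLaw ∧
      ∫ x : ℝ, Complex.exp (z * x) ∂sechLaw = (Complex.cos (Real.pi / 2 * z))⁻¹ := by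
  obtain ⟨h1, h2⟩ := integral_cexp_mul_sech hz
  have hfun : (fun x : ℝ => (1 / Real.pi * sech x) • Complex.exp (z * x))
      = fun x : ℝ => (1 / Real.pi : ℂ) * (Complex.exp (z * x) * (sech x : ℝ)) := by
    ext x
    rw [Complex.real_smul]
    push_cast
    ring
  rw [integrable_sechLaw_iff, integral_sechLaw, hfun]
  refine ⟨h1.const_mul _, ?_⟩
  rw [integral_const_mul, h2]
  have hpi : (Real.pi : ℂ) ≠ 0 := by exact_mod_cast Real.pi_ne_zero
  field_simp

lemma hasMGFOn_sechLaw : HasMGFOn sechLaw 1 (fun s => (Real.cos (Real.pi / 2 * s))⁻¹) := by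
  intro s hs
  obtain ⟨h1, h2⟩ := integral_cexp_sechLaw (z := s) (by simpa using hs)
  have hfun : (fun x : ℝ => Complex.exp (s * x)) = fun x : ℝ => ((Real.exp (s * x) : ℝ) : ℂ) := by
    ext x; push_cast; rfl
  rw [hfun] at h1 h2
  refine ⟨by simpa only [RCLike.re_to_complex, Complex.ofReal_re] using h1.re, ?_⟩
  rw [integral_complex_ofReal] at h2
  exact_mod_cast h2

lemma charFun_sechLaw (t : ℝ) : charFun sechLaw t = (sech (Real.pi / 2 * t) : ℝ) := by
  obtain ⟨-, h2⟩ := integral_cexp_sechLaw (z := t * Complex.I) (by simp)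
  rw [charFun_apply_real]
  calc _ = ∫ x : ℝ, Complex.exp (t * Complex.I * x) ∂sechLaw := by
        refine integral_congr_ae (.of_forall fun x => ?_)
        simp only
        congr 1
        ring
    _ = _ := by
        rw [h2, ← mul_assoc, Complex.cos_mul_I, sech]
        push_cast
        simp

instance isProbabilityMeasure_sechLaw : IsProbabilityMeasure sechLaw :=
  hasMGFOn_sechLaw.isProbabilityMeasure one_pos (by simp)

lemma sechLaw_absolutelyContinuous : sechLaw ≪ volume := withDensity_absolutelyContinuous _ _

/-! ### Laplace and gamma laws -/

lemma hasMGFOn_laplaceLaw : HasMGFOn laplaceLaw 1 (fun s => (1 - s ^ 2)⁻¹) := by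
  intro s hs
  obtain ⟨hs1, hs2⟩ := abs_lt.1 hs
  have hIoi : ∀ x ∈ Set.Ioi (0 : ℝ),
      (1 / 2 * Real.exp (-|x|)) * Real.exp (s * x) = 1 / 2 * Real.exp ((s - 1) * x) := by
    intro x hx
    rw [abs_of_pos hx, mul_assoc, ← Real.exp_add]
    ring_nf
  have hIic : ∀ x ∈ Set.Iic (0 : ℝ),
      (1 / 2 * Real.exp (-|x|)) * Real.exp (s * x) = 1 / 2 * Real.exp ((s + 1) * x) := by
    intro x hx
    rw [abs_of_nonpos hx, mul_assoc, ← Real.exp_add]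
    ring_nf
  have h1 : IntegrableOn (fun x => (1 / 2 * Real.exp (-|x|)) * Real.exp (s * x)) (Set.Ioi 0) :=
    IntegrableOn.congr_fun
      ((integrableOn_exp_mul_Ioi (a := s - 1) (by linarith) 0).const_mul (1 / 2))
      (fun x hx => (hIoi x hx).symm) measurableSet_Ioi
  have h2 : IntegrableOn (fun x => (1 / 2 * Real.exp (-|x|)) * Real.exp (s * x)) (Set.Iic 0) :=
    IntegrableOn.congr_fun
      ((integrableOn_exp_mul_Iic (a := s + 1) (by linarith) 0).const_mul (1 / 2))
      (fun x hx => (hIic x hx).symm) measurableSet_Iic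
  have hpos : ∀ x : ℝ, 0 ≤ 1 / 2 * Real.exp (-|x|) := fun x => by positivity
  have hlt : ∀ᵐ x : ℝ, ENNReal.ofReal (1 / 2 * Real.exp (-|x|)) < ⊤ :=
    .of_forall fun x => ENNReal.ofReal_lt_top
  rw [laplaceLaw, integrable_withDensity_iff_integrable_smul' (by fun_prop) hlt,
    integral_withDensity_eq_integral_toReal_smul (by fun_prop) hlt]
  simp only [ENNReal.toReal_ofReal (hpos _), smul_eq_mul]
  constructor
  · rw [← integrableOn_univ, ← Set.Iic_union_Ioi (a := (0 : ℝ))]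
    exact h2.union h1
  · rw [← intervalIntegral.integral_Iic_add_Ioi h2 h1, setIntegral_congr_fun measurableSet_Iic hIic,
      setIntegral_congr_fun measurableSet_Ioi hIoi, integral_const_mul, integral_const_mul,
      integral_exp_mul_Ioi (by linarith), integral_exp_mul_Iic (by linarith)]
    have ha : s - 1 ≠ 0 := by linarith
    have hb : s + 1 ≠ 0 := by linarith
    have hc : 1 - s ^ 2 ≠ 0 := by nlinarith
    simp only [mul_zero, Real.exp_zero]
    field_simp
    ring

instance isProbabilityMeasure_laplaceLaw : IsProbabilityMeasure laplaceLaw :=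
  hasMGFOn_laplaceLaw.isProbabilityMeasure one_pos (by simp)

/-- Exponential tilting: multiplying by exp(sx) changes the rate from 1 to 1 - s up to the factor
(1-s)^(-a), and the tilted density has total mass 1. -/
lemma hasMGFOn_gammaMeasure {a : ℝ} (ha : 0 < a) :
    HasMGFOn (gammaMeasure a 1) 1 (fun s => (1 - s) ^ (-a)) := by
  intro s hs
  have hs1 : 0 < 1 - s := by linarith [(abs_lt.1 hs).2]
  have hfun : ∀ x : ℝ, gammaPDFReal a 1 x * Real.exp (s * x)
      = (1 - s) ^ (-a) * gammaPDFReal a (1 - s) x := by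
    intro x
    simp only [gammaPDFReal]
    split_ifs with hx
    · rw [Real.one_rpow, Real.rpow_neg hs1.le]
      have h1 : (1 - s) ^ a ≠ 0 := (Real.rpow_pos_of_pos hs1 a).ne'
      have h2 : Real.exp (-((1 - s) * x)) = Real.exp (-(1 * x)) * Real.exp (s * x) := by
        rw [← Real.exp_add]; ring_nf
      rw [h2]
      field_simp
    · simp
  have hprob := isProbabilityMeasure_gammaMeasure ha hs1
  have hnn : ∀ r : ℝ, 0 < r → ∀ x, 0 ≤ gammaPDFReal a r x := fun r hr x =>
    gammaPDFReal_nonneg ha hr x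
  have hmeas : ∀ r, Measurable (gammaPDF a r) := fun r =>
    (measurable_gammaPDFReal a r).ennreal_ofReal
  have hto : ∀ r : ℝ, 0 < r → ∀ x, (gammaPDF a r x).toReal = gammaPDFReal a r x := fun r hr x =>
    ENNReal.toReal_ofReal (hnn r hr x)
  have hlt : ∀ r, ∀ᵐ x, gammaPDF a r x < ⊤ := fun r => .of_forall fun x => ENNReal.ofReal_lt_top
  have hi : Integrable (gammaPDFReal a (1 - s)) := by
    have h : Integrable (fun _ => (1 : ℝ)) (gammaMeasure a (1 - s)) := integrable_const 1
    rw [gammaMeasure, integrable_withDensity_iff_integrable_smul' (hmeas _) (hlt _)] at h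
    simpa only [hto _ hs1, smul_eq_mul, mul_one] using h
  have hv : ∫ x, gammaPDFReal a (1 - s) x = 1 := by
    have h : ∫ _, (1 : ℝ) ∂(gammaMeasure a (1 - s)) = 1 := by simp
    rw [gammaMeasure, integral_withDensity_eq_integral_toReal_smul (hmeas _) (hlt _)] at h
    simpa only [hto _ hs1, smul_eq_mul, mul_one] using h
  rw [gammaMeasure, integrable_withDensity_iff_integrable_smul' (hmeas _) (hlt _),
    integral_withDensity_eq_integral_toReal_smul (hmeas _) (hlt _)]
  simp only [hto _ one_pos, smul_eq_mul, hfun]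
  exact ⟨hi.const_mul _, by rw [integral_const_mul, hv, mul_one]⟩

/-- The symmetrized gamma law with moment generating function `(1 - s ^ 2) ^ (-a)`. -/
lemma exists_hasMGFOn_rpow {a : ℝ} (ha : 0 < a) :
    ∃ μ : Measure ℝ, IsProbabilityMeasure μ ∧ HasMGFOn μ 1 (fun s => (1 - s ^ 2) ^ (-a)) := by
  have hg := hasMGFOn_gammaMeasure ha
  have := isProbabilityMeasure_gammaMeasure ha one_pos
  have hm : Measurable fun x : ℝ => -1 * x := measurable_const_mul _
  have := Measure.isProbabilityMeasure_map (μ := gammaMeasure a 1) hm.aemeasurable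
  -- The law of a difference of two independent gamma variables; (1-s)^(-a)(1+s)^(-a) collapses to
  -- the desired power.
  refine ⟨_, inferInstance,
    (hg.conv (hg.map_const_mul one_pos (c := -1) (by simp))).congr fun s hs => ?_⟩
  obtain ⟨h1, h2⟩ := abs_lt.1 hs
  rw [← Real.mul_rpow (by linarith) (by linarith)]
  ring_nf

/-! ### Euler's cosine product and zeta values -/

lemma abs_mul_lt_one {c s : ℝ} (hc : |c| ≤ 1) (hs : |s| < 1) : |c * s| < 1 := by
  rw [abs_mul]
  exact mul_lt_one_of_nonneg_of_lt_one_right hc (abs_nonneg s) hs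

lemma abs_one_div_succ_le (n : ℕ) : |1 / ((n : ℝ) + 1)| ≤ 1 := by
  rw [abs_of_pos (by positivity), div_le_one (by positivity)]
  linarith [(Nat.cast_nonneg n : (0 : ℝ) ≤ n)]

lemma abs_one_div_odd_le (k : ℕ) : |1 / (2 * (k : ℝ) + 1)| ≤ 1 := by
  rw [abs_of_pos (by positivity), div_le_one (by positivity)]
  linarith [(Nat.cast_nonneg k : (0 : ℝ) ≤ k)]

/-- Euler's product for the cosine. -/
lemma tendsto_euler_cos_prod {s : ℝ} (hs : |s| < 1) :
    Tendsto (fun K : ℕ => ∏ k ∈ Finset.range K, (1 - (1 / (2 * (k : ℝ) + 1) * s) ^ 2)) atTop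
      (𝓝 (Real.cos (Real.pi / 2 * s))) := by
  rcases eq_or_ne s 0 with rfl | hs0
  · simp
  obtain ⟨hs1, hs2⟩ := abs_lt.1 hs
  have hpi := Real.pi_pos
  have hsin : Real.sin (Real.pi / 2 * s) ≠ 0 := by
    intro h
    rw [Real.sin_eq_zero_iff_of_lt_of_lt (by nlinarith) (by nlinarith)] at h
    exact hs0 (by simpa [hpi.ne'] using h)
  -- Uses cos(πs/2) = sin(πs) / (2 sin(πs/2)). The first 2N factors for sin(πs) split into N odd
  -- ones, which are wanted, and N even ones, which are the first N factors for sin(πs/2) and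
  -- cancel.
  have h1 := (Real.tendsto_euler_sin_prod s).comp (tendsto_id.const_mul_atTop' (two_pos (α := ℕ)))
  have h2 := Real.tendsto_euler_sin_prod (s / 2)
  have hev : ∀ᶠ N : ℕ in atTop,
      Real.pi * (s / 2) * ∏ j ∈ Finset.range N, (1 - (s / 2) ^ 2 / ((j : ℝ) + 1) ^ 2) ≠ 0 :=
    h2.eventually_ne (by rwa [show Real.pi * (s / 2) = Real.pi / 2 * s by ring])
  have h3 := (h1.div h2 (by rwa [show Real.pi * (s / 2) = Real.pi / 2 * s by ring])).div_const 2
  have hlim : Real.sin (Real.pi * s) / Real.sin (Real.pi * (s / 2)) / 2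
      = Real.cos (Real.pi / 2 * s) := by
    rw [show Real.pi * s = 2 * (Real.pi / 2 * s) by ring,
      show Real.pi * (s / 2) = Real.pi / 2 * s by ring, Real.sin_two_mul,
      mul_right_comm, mul_div_cancel_right₀ _ hsin, mul_div_cancel_left₀ _ two_ne_zero]
  rw [hlim] at h3
  refine h3.congr' ?_
  have hsplit : ∀ N : ℕ, ∏ j ∈ Finset.range (2 * N), (1 - s ^ 2 / ((j : ℝ) + 1) ^ 2)
      = (∏ k ∈ Finset.range N, (1 - (1 / (2 * (k : ℝ) + 1) * s) ^ 2)) *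
        ∏ j ∈ Finset.range N, (1 - (s / 2) ^ 2 / ((j : ℝ) + 1) ^ 2) := by
    intro N
    induction N with
    | zero => simp
    | succ N ih =>
      rw [show 2 * (N + 1) = 2 * N + 1 + 1 by ring, Finset.prod_range_succ,
        Finset.prod_range_succ, ih, Finset.prod_range_succ, Finset.prod_range_succ]
      have e1 : 1 - s ^ 2 / (((2 * N : ℕ) : ℝ) + 1) ^ 2 = 1 - (1 / (2 * (N : ℝ) + 1) * s) ^ 2 := by
        push_cast; field_simp
      have e2 : 1 - s ^ 2 / (((2 * N + 1 : ℕ) : ℝ) + 1) ^ 2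
          = 1 - (s / 2) ^ 2 / ((N : ℝ) + 1) ^ 2 := by
        push_cast
        rw [show (2 * (N : ℝ) + 1 + 1) = 2 * (N + 1) by ring]
        field_simp
      rw [e1, e2]
      ring
  filter_upwards [hev] with N hN
  change Real.pi * s * (∏ j ∈ Finset.range (2 * N), (1 - s ^ 2 / ((j : ℝ) + 1) ^ 2)) /
    (Real.pi * (s / 2) * ∏ j ∈ Finset.range N, (1 - (s / 2) ^ 2 / ((j : ℝ) + 1) ^ 2)) / 2 = _
  rw [hsplit]
  have hq := right_ne_zero_of_mul hN
  have hp := hpi.ne'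
  generalize ∏ j ∈ Finset.range N, (1 - (s / 2) ^ 2 / ((j : ℝ) + 1) ^ 2) = Q at hq ⊢
  generalize ∏ k ∈ Finset.range N, (1 - (1 / (2 * (k : ℝ) + 1) * s) ^ 2) = R
  field_simp

/-- The partial sums of a convergent series of logarithms. -/
lemma hasSum_log_of_tendsto_prod {f : ℕ → ℝ} (hf : ∀ n, 0 < f n) (hf1 : ∀ n, f n ≤ 1) {a : ℝ}
    (ha : 0 < a) (h : Tendsto (fun N => ∏ n ∈ Finset.range N, f n) atTop (𝓝 a)) :
    HasSum (fun n => -Real.log (f n)) (-Real.log a) := by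
  rw [hasSum_iff_tendsto_nat_of_nonneg fun n => by
    linarith [Real.log_nonpos (hf n).le (hf1 n)]]
  refine ((Real.continuousAt_log ha.ne').tendsto.comp h).neg.congr fun N => ?_
  simp only [Function.comp]
  rw [Real.log_prod fun n _ => (hf n).ne', Finset.sum_neg_distrib]

lemma cos_pi_div_two_mul_pos {s : ℝ} (hs : |s| < 1) : 0 < Real.cos (Real.pi / 2 * s) := by
  obtain ⟨h1, h2⟩ := abs_lt.1 hs
  have := Real.pi_pos
  exact Real.cos_pos_of_mem_Ioo ⟨by nlinarith, by nlinarith⟩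

/-- The logarithm of the secant as a double power series. -/
lemma hasSum_neg_log_one_sub_sq {s : ℝ} (hs : |s| < 1) :
    HasSum (fun k : ℕ => -Real.log (1 - (1 / (2 * (k : ℝ) + 1) * s) ^ 2))
      (-Real.log (Real.cos (Real.pi / 2 * s))) := by
  refine hasSum_log_of_tendsto_prod (fun k => ?_) (fun k => ?_) (cos_pi_div_two_mul_pos hs)
    (tendsto_euler_cos_prod hs)
  · linarith [(sq_lt_one_iff_abs_lt_one _).2 (abs_mul_lt_one (abs_one_div_odd_le k) hs)]
  · linarith [sq_nonneg (1 / (2 * (k : ℝ) + 1) * s)]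

/-- Euler's evaluation of ζ at even integers; since the sum is nonnegative, absolute values absorb
the alternating sign of the Bernoulli numbers. -/
lemma hasSum_inv_succ_pow (j : ℕ) :
    HasSum (fun n : ℕ => (1 / ((n : ℝ) + 1)) ^ (2 * (j + 1)))
      ((2 * Real.pi) ^ (2 * (j + 1)) * |(bernoulli (2 * (j + 1)) : ℝ)| /
        (2 * (2 * (j + 1)).factorial)) := by
  have h := hasSum_zeta_nat (k := j + 1) (Nat.succ_ne_zero j)
  rw [← hasSum_nat_add_iff' 1] at h
  simp only [Finset.range_one, Finset.sum_singleton, Nat.cast_zero, Nat.cast_add, Nat.cast_one]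
    at h
  rw [zero_pow (by omega), div_zero, sub_zero] at h
  have hfun : (fun n : ℕ => 1 / ((n : ℝ) + 1) ^ (2 * (j + 1)))
      = fun n : ℕ => (1 / ((n : ℝ) + 1)) ^ (2 * (j + 1)) := by
    ext n; rw [div_pow, one_pow]
  rw [hfun] at h
  have hnn := h.nonneg fun n => by positivity
  convert! h using 1
  rw [← abs_of_nonneg hnn, abs_div, abs_mul, abs_mul, abs_mul, abs_pow, abs_neg, abs_one, one_pow,
    one_mul, abs_of_pos (by positivity : (0 : ℝ) < 2 ^ (2 * (j + 1) - 1)),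
    abs_of_pos (by have := Real.pi_pos; positivity : (0 : ℝ) < Real.pi ^ (2 * (j + 1))),
    abs_of_pos (by positivity : (0 : ℝ) < ((2 * (j + 1)).factorial : ℝ)), mul_pow,
    show 2 * (j + 1) - 1 = 2 * j + 1 by omega, show 2 * (j + 1) = 2 * j + 1 + 1 by ring, pow_succ]
  field_simp

/-- The terms with even denominator contribute 2^(-m) Z, which leaves the rest to the odd ones. -/
lemma HasSum.inv_odd_pow {m : ℕ} {Z : ℝ}
    (h : HasSum (fun n : ℕ => (1 / ((n : ℝ) + 1)) ^ m) Z) :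
    HasSum (fun k : ℕ => (1 / (2 * (k : ℝ) + 1)) ^ m) ((1 - (1 / 2) ^ m) * Z) := by
  have e1 : (fun k : ℕ => (1 / (((2 * k : ℕ) : ℝ) + 1)) ^ m)
      = fun k : ℕ => (1 / (2 * (k : ℝ) + 1)) ^ m := by
    ext k; push_cast; rfl
  have e2 : (fun k : ℕ => (1 / (((2 * k + 1 : ℕ) : ℝ) + 1)) ^ m)
      = fun k : ℕ => (1 / 2) ^ m * (1 / ((k : ℝ) + 1)) ^ m := by
    ext k
    rw [← mul_pow]
    push_cast
    rw [show (2 * (k : ℝ) + 1 + 1) = 2 * (k + 1) by ring, one_div_mul_one_div]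
  have hodd : Summable fun k : ℕ => (1 / (2 * (k : ℝ) + 1)) ^ m := by
    rw [← e1]
    exact h.summable.comp_injective (mul_right_injective₀ (two_ne_zero (α := ℕ)))
  have h1 := hodd.hasSum
  have h2 := h.mul_left ((1 / 2) ^ m)
  have h3 : Z = (∑' k : ℕ, (1 / (2 * (k : ℝ) + 1)) ^ m) + (1 / 2) ^ m * Z := by
    refine h.unique (HasSum.even_add_odd ?_ ?_)
    · rw [e1]; exact h1
    · rw [e2]; exact h2
  rwa [show ∑' k : ℕ, (1 / (2 * (k : ℝ) + 1)) ^ m = (1 - (1 / 2) ^ m) * Z by linarith] at h1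

lemma summable_inv_succ_sq : Summable fun n : ℕ => (1 / ((n : ℝ) + 1)) ^ 2 :=
  (hasSum_inv_succ_pow 0).summable

lemma summable_inv_odd_sq : Summable fun k : ℕ => (1 / (2 * (k : ℝ) + 1)) ^ 2 :=
  summable_inv_succ_sq.hasSum.inv_odd_pow.summable

/-! ### The generating function of the weights -/

/-- The generating function of the weights `λ_m / m`. -/
noncomputable def writheMGF (z : ℝ) : ℝ := Real.exp (∑' m : ℕ, writheLambda m / m * z ^ m)

lemma hasSum_writheLambda_iff {z a : ℝ} :
    HasSum (fun m : ℕ => writheLambda m / m * z ^ m) a ↔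
      HasSum (fun j : ℕ => writheLambda (2 * (j + 1)) / (2 * (j + 1) : ℕ) * z ^ (2 * (j + 1))) a := by
  have hinj : Function.Injective fun j : ℕ => 2 * (j + 1) := fun a b h => by
    simp only at h; omega
  refine (hinj.hasSum_iff fun m hm => ?_).symm
  rcases Nat.even_or_odd m with ⟨k, hk⟩ | hodd
  · rcases Nat.eq_zero_or_pos m with rfl | hpos
    · simp
    · exact absurd ⟨k - 1, by simp only; omega⟩ hm
  · rw [writheLambda, if_neg (Nat.not_even_iff_odd.2 hodd)]
    simp

/-- The weight `λ_{2j+2} / (2j+2)` as a double series. -/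
lemma hasSum_writheLambda_even (s : ℝ) (j : ℕ) :
    HasSum (fun p : ℕ × ℕ =>
        ((1 / (2 * (p.2 : ℝ) + 1) * (1 / ((p.1 : ℝ) + 1) * s)) ^ 2) ^ (j + 1) / ((j : ℝ) + 1))
      (writheLambda (2 * (j + 1)) / (2 * (j + 1) : ℕ) * (Real.pi ^ 2 / 4 * s) ^ (2 * (j + 1))) := by
  have h := hasSum_inv_succ_pow j
  have hl : writheLambda (2 * (j + 1)) = (8 : ℝ) ^ (2 * (j + 1)) * ((2 : ℝ) ^ (2 * (j + 1)) - 1) *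
      |(bernoulli (2 * (j + 1)) : ℝ)| ^ 2 / (2 * ((2 * (j + 1)).factorial : ℝ) ^ 2) := by
    rw [writheLambda, if_pos (even_two_mul _), sq_abs]
  have hj : (((2 * (j + 1) : ℕ)) : ℝ) = 2 * ((j : ℝ) + 1) := by push_cast; ring
  have hF : ((2 * (j + 1)).factorial : ℝ) ≠ 0 := by positivity
  have hpow : ∀ p : ℕ × ℕ,
      ((1 / (2 * (p.2 : ℝ) + 1) * (1 / ((p.1 : ℝ) + 1) * s)) ^ 2) ^ (j + 1) / ((j : ℝ) + 1)
      = s ^ (2 * (j + 1)) / ((j : ℝ) + 1) * ((1 / ((p.1 : ℝ) + 1)) ^ (2 * (j + 1)) *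
        (1 / (2 * (p.2 : ℝ) + 1)) ^ (2 * (j + 1))) := fun p => by
    rw [← pow_mul, mul_pow, mul_pow]
    ring
  simp only [hpow]
  rw [hl, hj]
  clear hpow hl hj
  generalize ((2 * (j + 1)).factorial : ℝ) = F at h hF ⊢
  generalize |(bernoulli (2 * (j + 1)) : ℝ)| = b at h ⊢
  generalize 2 * (j + 1) = m at h ⊢
  have h2 := h.inv_odd_pow
  have h12 := (h.mul h2 (h.summable.mul_of_nonneg h2.summable (fun n => by positivity)
    fun k => by positivity)).mul_left (s ^ m / ((j : ℝ) + 1))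
  refine (congrArg (HasSum _) ?_).mp h12
  -- The remaining identity rests on (2π)^(2m) (1 - 2^(-m)) = 8^m (2^m - 1) (π²/4)^m.
  have h8 : (8 : ℝ) ^ m = 2 ^ m * (2 ^ m * 2 ^ m) := by
    rw [← mul_pow, ← mul_pow]; norm_num
  have h4 : (4 : ℝ) ^ m = 2 ^ m * 2 ^ m := by
    rw [← mul_pow]; norm_num
  rw [h8, mul_pow (Real.pi ^ 2 / 4), div_pow (Real.pi ^ 2), h4, mul_pow, one_div, inv_pow,
    pow_right_comm]
  have h2m : (2 : ℝ) ^ m ≠ 0 := by positivity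
  have hj1 : (j : ℝ) + 1 ≠ 0 := by positivity
  field_simp

/-- Dominated by the product of two convergent sums of inverse squares and a geometric series in s²;
it justifies the interchange of summations. -/
lemma summable_triple {s : ℝ} (hs : |s| < 1) :
    Summable (fun p : (ℕ × ℕ) × ℕ =>
      ((1 / (2 * (p.1.2 : ℝ) + 1) * (1 / ((p.1.1 : ℝ) + 1) * s)) ^ 2) ^ (p.2 + 1)
        / ((p.2 : ℝ) + 1)) := by
  have h1 := summable_inv_succ_sq
  have h2 := summable_inv_odd_sq
  have h3 : Summable fun j : ℕ => (s ^ 2) ^ j :=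
    summable_geometric_of_lt_one (sq_nonneg s) ((sq_lt_one_iff_abs_lt_one s).2 hs)
  have h123 := (h1.mul_of_nonneg h2 (fun n => by positivity) fun k => by positivity).mul_of_nonneg
    h3 (fun p => by positivity) fun j => by positivity
  refine Summable.of_nonneg_of_le (fun p => by positivity) (fun p => ?_) h123
  obtain ⟨⟨n, k⟩, j⟩ := p
  have hs2 : s ^ 2 ≤ 1 := ((sq_lt_one_iff_abs_lt_one s).2 hs).le
  have ha : (1 / ((n : ℝ) + 1)) ^ 2 ≤ 1 := (sq_le_one_iff_abs_le_one _).2 (abs_one_div_succ_le n)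
  have hb : (1 / (2 * (k : ℝ) + 1)) ^ 2 ≤ 1 := (sq_le_one_iff_abs_le_one _).2 (abs_one_div_odd_le k)
  simp only
  set A := (1 / ((n : ℝ) + 1)) ^ 2
  set B := (1 / (2 * (k : ℝ) + 1)) ^ 2
  have hA : 0 ≤ A := by positivity
  have hB : 0 ≤ B := by positivity
  calc ((1 / (2 * (k : ℝ) + 1) * (1 / ((n : ℝ) + 1) * s)) ^ 2) ^ (j + 1) / ((j : ℝ) + 1)
      ≤ ((1 / (2 * (k : ℝ) + 1) * (1 / ((n : ℝ) + 1) * s)) ^ 2) ^ (j + 1) :=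
        div_le_self (by positivity) (by linarith [(Nat.cast_nonneg j : (0 : ℝ) ≤ j)])
    _ = (A * B * s ^ 2) * (A * B * s ^ 2) ^ j := by
        rw [← pow_succ']; congr 1; simp only [A, B]; ring
    _ ≤ (A * B * 1) * (1 * s ^ 2) ^ j := by
        gcongr
        exact mul_le_one₀ ha hB hb
    _ = A * B * (s ^ 2) ^ j := by rw [mul_one, one_mul]

/-- The logarithm of the product of the secants is the power series with coefficients
`λ_m / m`. -/
lemma hasSum_log_cos_writhe {s : ℝ} (hs : |s| < 1) :
    ∃ a : ℝ, HasSum (fun m : ℕ => writheLambda m / m * (Real.pi ^ 2 / 4 * s) ^ m) a ∧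
      HasSum (fun n : ℕ => -Real.log (Real.cos (Real.pi / 2 * (1 / ((n : ℝ) + 1) * s)))) a := by
  obtain ⟨a, ha⟩ := summable_triple hs
  have hns : ∀ n : ℕ, |1 / ((n : ℝ) + 1) * s| < 1 := fun n =>
    abs_mul_lt_one (abs_one_div_succ_le n) hs
  let x : ℕ × ℕ → ℝ := fun p => 1 / (2 * (p.2 : ℝ) + 1) * (1 / ((p.1 : ℝ) + 1) * s)
  let F : (ℕ × ℕ) × ℕ → ℝ := fun p => ((x p.1) ^ 2) ^ (p.2 + 1) / ((p.2 : ℝ) + 1)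
  have hF : HasSum F a := ha
  refine ⟨a, hasSum_writheLambda_iff.2 ?_, ?_⟩
  -- Here the exponent index is outermost: the sum over n and k gives the weight.
  · have hF' : HasSum (fun p : ℕ × (ℕ × ℕ) => F (p.2, p.1)) a :=
      (Equiv.prodComm ℕ (ℕ × ℕ)).hasSum_iff.2 hF
    exact HasSum.prod_fiberwise (f := fun p : ℕ × (ℕ × ℕ) => F (p.2, p.1)) hF'
      fun j => hasSum_writheLambda_even s j
  -- Here the exponent index is innermost and gives a logarithm; the sum over k is then Euler's
  -- product for a fixed n.
  · have hx : ∀ p, |(x p) ^ 2| < 1 := fun p => by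
      rw [abs_pow]
      exact pow_lt_one₀ (abs_nonneg _) (abs_mul_lt_one (abs_one_div_odd_le p.2) (hns p.1))
        two_ne_zero
    have hfib : ∀ p, HasSum (fun j : ℕ => F (p, j)) (-Real.log (1 - (x p) ^ 2)) := fun p =>
      Real.hasSum_pow_div_log_of_abs_lt_one (x := (x p) ^ 2) (hx p)
    have hlog : HasSum (fun p => -Real.log (1 - (x p) ^ 2)) a := hF.prod_fiberwise hfib
    exact HasSum.prod_fiberwise (f := fun p => -Real.log (1 - (x p) ^ 2)) hlog
      fun n => hasSum_neg_log_one_sub_sq (s := 1 / ((n : ℝ) + 1) * s) (hns n)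

lemma summable_writheLambda {z : ℝ} (hz : |z| < Real.pi ^ 2 / 4) :
    Summable fun m : ℕ => writheLambda m / m * z ^ m := by
  have hpi : 0 < Real.pi ^ 2 / 4 := by positivity
  have hs : |z / (Real.pi ^ 2 / 4)| < 1 := by
    rwa [abs_div, abs_of_pos hpi, div_lt_one hpi]
  obtain ⟨a, h, -⟩ := hasSum_log_cos_writhe hs
  rw [mul_div_cancel₀ _ hpi.ne'] at h
  exact h.summable

lemma tendsto_prod_sec {s : ℝ} (hs : |s| < 1) :
    Tendsto (fun N : ℕ => ∏ n ∈ Finset.range N,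
        (Real.cos (Real.pi / 2 * (1 / ((n : ℝ) + 1) * s)))⁻¹) atTop
      (𝓝 (writheMGF (Real.pi ^ 2 / 4 * s))) := by
  obtain ⟨a, h1, h2⟩ := hasSum_log_cos_writhe hs
  rw [writheMGF, h1.tsum_eq]
  refine ((Real.continuous_exp.tendsto a).comp h2.tendsto_sum_nat).congr fun N => ?_
  simp only [Function.comp]
  rw [Real.exp_sum]
  refine Finset.prod_congr rfl fun n _ => ?_
  rw [Real.exp_neg, Real.exp_log]
  exact cos_pi_div_two_mul_pos (abs_mul_lt_one (abs_one_div_succ_le n) hs)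

/-! ### Existence and identification of the law -/

lemma HasMGFOn.scale_writhe {μ : Measure ℝ} {M : ℝ → ℝ}
    (h : HasMGFOn μ 1 (fun s => M (Real.pi ^ 2 / 4 * s))) :
    HasMGFOn (μ.map fun x => 4 / Real.pi ^ 2 * x) (Real.pi ^ 2 / 4) M := by
  have hpi : Real.pi ≠ 0 := Real.pi_ne_zero
  refine (h.map_const_mul one_pos (c := 4 / Real.pi ^ 2) ?_).congr fun s _ => ?_
  · rw [abs_of_pos (by positivity)]
    exact le_of_eq (by field_simp)
  · congr 1
    field_simp

lemma hasWritheMGF_iff {W : ProbabilityMeasure ℝ} :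
    HasWritheMGF W ↔ HasMGFOn (W : Measure ℝ) (Real.pi ^ 2 / 4) writheMGF :=
  ⟨fun h z hz => ⟨(h z hz).1, (h z hz).2.2⟩,
    fun h z hz => ⟨(h z hz).1, summable_writheLambda hz, (h z hz).2⟩⟩

/-- The common route to every representation of `W`: only the transform on |s| < 1 of the unscaled
variable has to be computed. -/
lemma HasWritheMGF.eq_map {W : ProbabilityMeasure ℝ} (hW : HasWritheMGF W) {μ : Measure ℝ}
    [IsFiniteMeasure μ] (h : HasMGFOn μ 1 (fun s => writheMGF (Real.pi ^ 2 / 4 * s))) :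
    (W : Measure ℝ) = μ.map fun x => 4 / Real.pi ^ 2 * x :=
  HasMGFOn.measure_eq (by have := Real.pi_pos; positivity) (hasWritheMGF_iff.1 hW) h.scale_writhe

lemma writheMGF_pos (z : ℝ) : 0 < writheMGF z := Real.exp_pos _

lemma cos_inv_even (s : ℝ) :
    (Real.cos (Real.pi / 2 * -s))⁻¹ = (Real.cos (Real.pi / 2 * s))⁻¹ := by
  rw [mul_neg, Real.cos_neg]

/-- The series `∑ A n / (n + 1)` of iid hyperbolic secant variables. -/
lemma exists_sech_series {Ω : Type*} [MeasurableSpace Ω] {P : Measure Ω} [IsProbabilityMeasure P]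
    {A : ℕ → Ω → ℝ} (hA : iIndepFun A P) (hlaw : ∀ n, HasLaw (A n) sechLaw P) :
    ∃ S : Ω → ℝ, Measurable S ∧
      (∀ᵐ ω ∂P, Tendsto (fun N => ∑ n ∈ Finset.range N, A n ω / ((n : ℝ) + 1)) atTop (𝓝 (S ω))) ∧
      HasMGFOn (P.map S) 1 (fun s => writheMGF (Real.pi ^ 2 / 4 * s)) ∧
      ∀ t, Tendsto (fun N => ∏ n ∈ Finset.range N, charFun sechLaw (1 / ((n : ℝ) + 1) * t)) atTop
        (𝓝 (charFun (P.map S) t)) := by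
  obtain ⟨S, hS, hlim, hM, hφ⟩ := exists_weighted_series_limit hA hlaw one_pos one_pos
    hasMGFOn_sechLaw cos_inv_even (c := fun n : ℕ => 1 / ((n : ℝ) + 1))
    (fun n => by rw [mul_one]; exact abs_one_div_succ_le n) fun s hs => tendsto_prod_sec hs
  refine ⟨S, hS, ?_, hM, hφ⟩
  simpa only [one_div_mul_eq_div] using hlim

lemma HasWritheMGF.hasLaw {W : ProbabilityMeasure ℝ} (hW : HasWritheMGF W) {Ω : Type*}
    [MeasurableSpace Ω] {P : Measure Ω} [IsProbabilityMeasure P] {S : Ω → ℝ} (hS : Measurable S)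
    (h : HasMGFOn (P.map S) 1 (fun s => writheMGF (Real.pi ^ 2 / 4 * s))) :
    HasLaw (fun ω => 4 / Real.pi ^ 2 * S ω) (W : Measure ℝ) P := by
  refine ⟨(hS.const_mul _).aemeasurable, ?_⟩
  rw [hW.eq_map h, Measure.map_map (measurable_const_mul _) hS]
  rfl

theorem existsUnique_hasWritheMGF : ∃! W : ProbabilityMeasure ℝ, HasWritheMGF W := by
  obtain ⟨Ω, _, P, A, -, hlaw, hind, _⟩ := exists_iid ℕ sechLaw
  obtain ⟨S, hS, -, hM, -⟩ := exists_sech_series hind hlaw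
  have := Measure.isProbabilityMeasure_map (μ := P) hS.aemeasurable
  have hm : Measurable fun x : ℝ => 4 / Real.pi ^ 2 * x := measurable_const_mul _
  have := Measure.isProbabilityMeasure_map (μ := P.map S) hm.aemeasurable
  refine ⟨⟨(P.map S).map fun x => 4 / Real.pi ^ 2 * x, this⟩, hasWritheMGF_iff.2 hM.scale_writhe,
    fun W hW => ?_⟩
  exact Subtype.ext (hW.eq_map hM)

/-! ### Characteristic function and absolute continuity -/

/-- Follows from cosh x ≤ exp(x²/2). It makes the product of secants absolutely convergent, so the
limit over initial segments becomes an unconditional product. -/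
lemma norm_sech_sub_one_le (x : ℝ) : ‖((sech x : ℝ) : ℂ) - 1‖ ≤ x ^ 2 / 2 := by
  have h1 : sech x ≤ 1 := (div_le_one (Real.cosh_pos x)).2 (Real.one_le_cosh x)
  have h2 : Real.exp (-(x ^ 2 / 2)) ≤ sech x := by
    rw [Real.exp_neg, sech, one_div]
    exact inv_anti₀ (Real.cosh_pos x) (Real.cosh_le_exp_half_sq x)
  have h3 := Real.add_one_le_exp (-(x ^ 2 / 2))
  rw [← Complex.ofReal_one, ← Complex.ofReal_sub, Complex.norm_real, Real.norm_eq_abs,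
    abs_of_nonpos (by linarith)]
  linarith

theorem HasWritheMGF.hasProd_charFun {W : ProbabilityMeasure ℝ} (hW : HasWritheMGF W) (t : ℝ) :
    HasProd (fun n : ℕ => ((sech (2 * t / (Real.pi * ((n : ℝ) + 1))) : ℝ) : ℂ))
      (charFun (W : Measure ℝ) t) := by
  obtain ⟨Ω, _, P, A, -, hlaw, hind, _⟩ := exists_iid ℕ sechLaw
  obtain ⟨S, hS, -, hM, hφ⟩ := exists_sech_series hind hlaw
  have hmul : Multipliable
      fun n : ℕ => ((sech (2 * t / (Real.pi * ((n : ℝ) + 1))) : ℝ) : ℂ) := by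
    have hs : Summable fun n : ℕ =>
        ‖((sech (2 * t / (Real.pi * ((n : ℝ) + 1))) : ℝ) : ℂ) - 1‖ := by
      refine Summable.of_nonneg_of_le (fun n => norm_nonneg _) (fun n => norm_sech_sub_one_le _) ?_
      refine (summable_inv_succ_sq.mul_left ((2 * t / Real.pi) ^ 2 / 2)).congr fun n => ?_
      field_simp
    simpa using multipliable_one_add_of_summable hs
  rw [hmul.hasProd_iff_tendsto_nat, hW.eq_map (μ := P.map S) hM, charFun_map_mul]
  refine (hφ (4 / Real.pi ^ 2 * t)).congr fun N => Finset.prod_congr rfl fun n _ => ?_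
  rw [charFun_sechLaw]
  congr 2
  have := Real.pi_ne_zero
  field_simp
  ring

/-- Up to scale, `W` is the convolution of the secant law, the first summand, with the law of the
remaining series; convolving with an absolutely continuous law preserves absolute continuity. -/
theorem HasWritheMGF.absolutelyContinuous {W : ProbabilityMeasure ℝ} (hW : HasWritheMGF W) :
    (W : Measure ℝ) ≪ volume := by
  obtain ⟨Ω, _, P, A, -, hlaw, hind, _⟩ := exists_iid ℕ sechLaw
  have hG : ∀ s : ℝ, |s| < 1 → Tendsto (fun N : ℕ => ∏ n ∈ Finset.range N,
      (Real.cos (Real.pi / 2 * (1 / (((n + 1 : ℕ) : ℝ) + 1) * s)))⁻¹) atTop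
      (𝓝 (writheMGF (Real.pi ^ 2 / 4 * s) * Real.cos (Real.pi / 2 * s))) := fun s hs => by
    have h := (((tendsto_prod_sec hs).comp (tendsto_add_atTop_nat 1)).mul_const
      (Real.cos (Real.pi / 2 * s)))
    refine h.congr fun N => ?_
    simp only [Function.comp]
    rw [Finset.prod_range_succ', mul_assoc]
    simp [(cos_pi_div_two_mul_pos hs).ne']
  obtain ⟨R, hR, -, hM, -⟩ := exists_weighted_series_limit hind hlaw one_pos one_pos
    hasMGFOn_sechLaw cos_inv_even (c := fun n : ℕ => 1 / (((n + 1 : ℕ) : ℝ) + 1))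
    (fun n => by rw [mul_one]; exact abs_one_div_succ_le _) hG
  have := Measure.isProbabilityMeasure_map (μ := P) hR.aemeasurable
  have hconv := (hM.conv hasMGFOn_sechLaw).congr (N := fun s => writheMGF (Real.pi ^ 2 / 4 * s))
    fun s hs => by
      rw [mul_assoc, mul_inv_cancel₀ (cos_pi_div_two_mul_pos hs).ne', mul_one]
  have hac : P.map R ∗ sechLaw ≪ volume :=
    Measure.conv_absolutelyContinuous sechLaw_absolutelyContinuous
  rw [hW.eq_map hconv]
  have hc : (4 / Real.pi ^ 2 : ℝ) ≠ 0 := by have := Real.pi_pos; positivity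
  refine (hac.map (measurable_const_mul _)).trans ?_
  have := Real.map_volume_mul_left hc
  rw [this]
  exact Measure.smul_absolutelyContinuous

/-! ### The double Laplace series -/

lemma tendsto_prod_laplace {s : ℝ} (hs : |s| < 1) :
    Tendsto (fun K : ℕ => ∏ k ∈ Finset.range K, (1 - (1 / (2 * (k : ℝ) + 1) * s) ^ 2)⁻¹) atTop
      (𝓝 (Real.cos (Real.pi / 2 * s))⁻¹) := by
  refine ((tendsto_euler_cos_prod hs).inv₀ (cos_pi_div_two_mul_pos hs).ne').congr fun K => ?_
  rw [Finset.prod_inv_distrib]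

/-- The hyperbolic secant law as the law of a function of a Laplace sequence. -/
lemma exists_laplace_series :
    ∃ τ : (ℕ → ℝ) → ℝ, Measurable τ ∧
      (∀ᵐ x ∂(Measure.infinitePi fun _ : ℕ => laplaceLaw),
        Tendsto (fun K => ∑ k ∈ Finset.range K, 1 / (2 * (k : ℝ) + 1) * x k) atTop (𝓝 (τ x))) ∧
      (Measure.infinitePi fun _ : ℕ => laplaceLaw).map τ = sechLaw := by
  -- Working on sequence space makes the limit a single measurable function of the sequence, which
  -- can later be applied to each column of an array.
  have hind : iIndepFun (fun (k : ℕ) (x : ℕ → ℝ) => x k)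
      (Measure.infinitePi fun _ : ℕ => laplaceLaw) :=
    iIndepFun_infinitePi (X := fun _ x => x) fun _ => measurable_id
  have hlaw : ∀ k : ℕ, HasLaw (fun x : ℕ → ℝ => x k) laplaceLaw
      (Measure.infinitePi fun _ : ℕ => laplaceLaw) := fun k =>
    (measurePreserving_eval_infinitePi (fun _ : ℕ => laplaceLaw) k).hasLaw
  obtain ⟨τ, hτ, hlim, hM, -⟩ := exists_weighted_series_limit hind hlaw one_pos one_pos
    hasMGFOn_laplaceLaw (fun s => by rw [neg_sq]) (c := fun k : ℕ => 1 / (2 * (k : ℝ) + 1))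
    (fun k => by rw [mul_one]; exact abs_one_div_odd_le k) fun s hs => tendsto_prod_laplace hs
  exact ⟨τ, hτ, hlim, hM.measure_eq one_pos hasMGFOn_sechLaw⟩

/-- The columns of an independent array are independent. -/
lemma iIndepFun_columns {Ω : Type*} [MeasurableSpace Ω] {P : Measure Ω} [IsProbabilityMeasure P]
    {L : ℕ → ℕ → Ω → ℝ} (hm : ∀ k n, Measurable (L k n))
    (hL : iIndepFun (fun p : ℕ × ℕ => L p.1 p.2) P) :
    iIndepFun (fun n ω k => L k n ω) P := by
  have hprob : ∀ k n, IsProbabilityMeasure (P.map (L k n)) := fun k n =>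
    Measure.isProbabilityMeasure_map (hm k n).aemeasurable
  have hswap : iIndepFun (fun p : ℕ × ℕ => L p.2 p.1) P := hL.precomp Prod.swap_injective
  have hcol : ∀ n, iIndepFun (fun k => L k n) P := fun n =>
    hL.precomp (g := fun k : ℕ => (k, n)) fun a b h => (Prod.mk.inj h).1
  rw [iIndepFun_iff_map_fun_eq_infinitePi_map (fun n => by fun_prop)]
  have h1 := (iIndepFun_iff_map_fun_eq_infinitePi_map fun p : ℕ × ℕ => hm p.2 p.1).1 hswap
  have h2 := Measure.infinitePi_map_curry (fun n k => P.map (L k n))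
  -- The joint law of the array is a product measure; currying it gives a product over columns of
  -- products over rows.
  rw [← h1, Measure.map_map (by fun_prop) (by fun_prop)] at h2
  refine Eq.trans ?_ (h2.trans ?_)
  · rfl
  · congr 1
    ext1 n
    exact ((iIndepFun_iff_map_fun_eq_infinitePi_map (fun k => hm k n)).1 (hcol n)).symm

theorem HasWritheMGF.laplace_series {W : ProbabilityMeasure ℝ} (hW : HasWritheMGF W) {Ω : Type*}
    [MeasurableSpace Ω] {P : Measure Ω} [IsProbabilityMeasure P] {L : ℕ → ℕ → Ω → ℝ}
    (hL : iIndepFun (fun p : ℕ × ℕ => L p.1 p.2) P) (hlaw : ∀ k n, HasLaw (L k n) laplaceLaw P) :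
    ∃ (T : ℕ → Ω → ℝ) (S : Ω → ℝ),
      (∀ᵐ ω ∂P, ∀ n : ℕ, Tendsto
        (fun K : ℕ => ∑ k ∈ Finset.range K,
          L k n ω / ((2 * (k : ℝ) + 1) * ((n : ℝ) + 1))) atTop (𝓝 (T n ω))) ∧
      (∀ᵐ ω ∂P, Tendsto
        (fun N : ℕ => ∑ n ∈ Finset.range N, T n ω) atTop (𝓝 (S ω))) ∧
      HasLaw (fun ω => 4 / Real.pi ^ 2 * S ω) (W : Measure ℝ) P := by
  obtain ⟨τ, hτ, hτlim, hτlaw⟩ := exists_laplace_series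
  let L' : ℕ → ℕ → Ω → ℝ := fun k n => (hlaw k n).aemeasurable.mk
  have hm : ∀ k n, Measurable (L' k n) := fun k n => (hlaw k n).aemeasurable.measurable_mk
  have hLL' : ∀ k n, L k n =ᵐ[P] L' k n := fun k n => (hlaw k n).aemeasurable.ae_eq_mk
  have hlaw' : ∀ k n, P.map (L' k n) = laplaceLaw := fun k n => by
    rw [← Measure.map_congr (hLL' k n), (hlaw k n).map_eq]
  have hind' : iIndepFun (fun p : ℕ × ℕ => L' p.1 p.2) P := hL.congr fun p => hLL' p.1 p.2
  have hcolm : ∀ n, Measurable fun ω k => L' k n ω := fun n =>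
    measurable_pi_lambda _ fun k => hm k n
  have hcol : iIndepFun (fun n ω k => L' k n ω) P := iIndepFun_columns hm hind'
  have hcollaw : ∀ n, P.map (fun ω k => L' k n ω) = Measure.infinitePi fun _ => laplaceLaw :=
    fun n => by
      have h : iIndepFun (fun k => L' k n) P :=
        hind'.precomp (g := fun k : ℕ => (k, n)) fun a b h => (Prod.mk.inj h).1
      rw [(iIndepFun_iff_map_fun_eq_infinitePi_map (fun k => hm k n)).1 h]
      simp only [hlaw']
  have hA : iIndepFun (fun n ω => τ fun k => L' k n ω) P := hcol.comp (fun _ => τ) fun _ => hτ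
  have hAlaw : ∀ n, HasLaw (fun ω => τ fun k => L' k n ω) sechLaw P := fun n => by
    refine ⟨(hτ.comp (hcolm n)).aemeasurable, ?_⟩
    rw [← hτlaw, ← hcollaw n, Measure.map_map hτ (hcolm n)]
    rfl
  obtain ⟨S, hS, hSlim, hSM, -⟩ := exists_sech_series hA hAlaw
  refine ⟨fun n ω => (τ fun k => L' k n ω) / ((n : ℝ) + 1), S, ?_, hSlim, hW.hasLaw hS hSM⟩
  -- Almost sure convergence on sequence space is pulled back along the column, whose law is the
  -- product of Laplace laws.
  have hinner : ∀ n, ∀ᵐ ω ∂P, Tendsto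
      (fun K => ∑ k ∈ Finset.range K, 1 / (2 * (k : ℝ) + 1) * L' k n ω) atTop
      (𝓝 (τ fun k => L' k n ω)) := fun n =>
    ae_of_ae_map (hcolm n).aemeasurable (by rw [hcollaw]; exact hτlim)
  filter_upwards [ae_all_iff.2 hinner, ae_all_iff.2 fun k => ae_all_iff.2 (hLL' k)] with ω h1 h2 n
  refine ((h1 n).div_const _).congr fun K => ?_
  rw [Finset.sum_div]
  refine Finset.sum_congr rfl fun k _ => ?_
  rw [h2 k n, one_div_mul_eq_div, div_div]

/-! ### Infinite divisibility -/

/-- For every `a > 0` there is a law whose moment generating function is the `a`-th power of that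
of `W`. -/
lemma exists_hasMGFOn_writheMGF_rpow {a : ℝ} (ha : 0 < a) :
    ∃ μ : Measure ℝ, IsProbabilityMeasure μ ∧
      HasMGFOn μ (Real.pi ^ 2 / 4) (fun z => writheMGF z ^ a) := by
  obtain ⟨γ, _, hγ⟩ := exists_hasMGFOn_rpow ha
  obtain ⟨Ω, _, P, X, -, hXlaw, hXind, _⟩ := exists_iid ℕ γ
  have hnn : ∀ s : ℝ, |s| < 1 → ∀ k : ℕ, 0 ≤ 1 - (1 / (2 * (k : ℝ) + 1) * s) ^ 2 := fun s hs k => by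
    linarith [(sq_lt_one_iff_abs_lt_one _).2 (abs_mul_lt_one (abs_one_div_odd_le k) hs)]
  have hprod1 : ∀ s : ℝ, |s| < 1 → Tendsto (fun K : ℕ => ∏ k ∈ Finset.range K,
      (1 - (1 / (2 * (k : ℝ) + 1) * s) ^ 2) ^ (-a)) atTop
      (𝓝 (Real.cos (Real.pi / 2 * s) ^ (-a))) := fun s hs => by
    refine ((tendsto_euler_cos_prod hs).rpow_const
      (.inl (cos_pi_div_two_mul_pos hs).ne')).congr fun K => ?_
    exact (Real.finsetProd_rpow _ _ (fun k _ => hnn s hs k) _).symm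
  -- This series replaces the secant law by one with transform cos(πs/2)^(-a); a second series, with
  -- weights 1/(n+1), then gives the power of the whole product.
  obtain ⟨S, hS, -, hSM, -⟩ := exists_weighted_series_limit hXind hXlaw one_pos one_pos
    hγ (fun s => by rw [neg_sq]) (c := fun k : ℕ => 1 / (2 * (k : ℝ) + 1))
    (fun k => by rw [mul_one]; exact abs_one_div_odd_le k) hprod1
  have := Measure.isProbabilityMeasure_map (μ := P) hS.aemeasurable
  obtain ⟨Ω', _, P', Y, -, hYlaw, hYind, _⟩ := exists_iid ℕ (P.map S)
  have hprod2 : ∀ s : ℝ, |s| < 1 → Tendsto (fun N : ℕ => ∏ n ∈ Finset.range N,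
      Real.cos (Real.pi / 2 * (1 / ((n : ℝ) + 1) * s)) ^ (-a)) atTop
      (𝓝 (writheMGF (Real.pi ^ 2 / 4 * s) ^ a)) := fun s hs => by
    refine ((tendsto_prod_sec hs).rpow_const (.inl (writheMGF_pos _).ne')).congr fun N => ?_
    have hcos : ∀ n : ℕ, 0 < Real.cos (Real.pi / 2 * (1 / ((n : ℝ) + 1) * s)) := fun n =>
      cos_pi_div_two_mul_pos (abs_mul_lt_one (abs_one_div_succ_le n) hs)
    rw [← Real.finsetProd_rpow _ _ fun n _ => (inv_pos.2 (hcos n)).le]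
    refine Finset.prod_congr rfl fun n _ => ?_
    rw [Real.inv_rpow (hcos n).le, Real.rpow_neg (hcos n).le]
  obtain ⟨R, hR, -, hRM, -⟩ := exists_weighted_series_limit hYind hYlaw one_pos one_pos
    hSM (fun s => by rw [mul_neg, Real.cos_neg]) (c := fun n : ℕ => 1 / ((n : ℝ) + 1))
    (fun n => by rw [mul_one]; exact abs_one_div_succ_le n) hprod2
  have := Measure.isProbabilityMeasure_map (μ := P') hR.aemeasurable
  have hm : Measurable fun x : ℝ => 4 / Real.pi ^ 2 * x := measurable_const_mul _
  exact ⟨_, Measure.isProbabilityMeasure_map hm.aemeasurable,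
    HasMGFOn.scale_writhe (M := fun z => writheMGF z ^ a) hRM⟩

theorem HasWritheMGF.isInfinitelyDivisible {W : ProbabilityMeasure ℝ} (hW : HasWritheMGF W) :
    IsInfinitelyDivisible (W : Measure ℝ) := by
  intro n hn
  have hn0 : (0 : ℝ) < n := by exact_mod_cast hn
  obtain ⟨μ, _, hμ⟩ := exists_hasMGFOn_writheMGF_rpow (one_div_pos.2 hn0)
  obtain ⟨Ω, mΩ, P, X, hm, hlaw, hind, hP⟩ := exists_iid (Fin n) μ
  refine ⟨Ω, mΩ, P, X, hP, hind, fun i j => ⟨(hm i).aemeasurable, (hm j).aemeasurable, ?_⟩,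
    by fun_prop, ?_⟩
  · rw [(hlaw i).map_eq, (hlaw j).map_eq]
  · have hXM : ∀ i, HasMGFOn (P.map (X i)) (Real.pi ^ 2 / 4)
        (fun z => writheMGF z ^ (1 / (n : ℝ))) := fun i => by rwa [(hlaw i).map_eq]
    have hsum := (hasMGFOn_map_sum hind hm hXM Finset.univ).congr (N := writheMGF) fun z _ => by
      simp only [Finset.prod_const, Finset.card_univ, Fintype.card_fin]
      rw [← Real.rpow_mul_natCast (writheMGF_pos z).le, one_div_mul_cancel hn0.ne', Real.rpow_one]
    exact hsum.measure_eq (by have := Real.pi_pos; positivity) (hasWritheMGF_iff.1 hW)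

theorem mainTheorem5 :
    -- The law `W` exists and is determined by its moment generating function.
    (∃! W : ProbabilityMeasure ℝ, HasWritheMGF W) ∧
    ∀ W : ProbabilityMeasure ℝ, HasWritheMGF W →
      -- The characteristic function is `∏_{n ≥ 1} sech (2t / (π n))`.
      (∀ t : ℝ, HasProd
        (fun n : ℕ => ((sech (2 * t / (Real.pi * ((n : ℝ) + 1))) : ℝ) : ℂ))
        (charFun (W : Measure ℝ) t)) ∧
      -- `W ∼ (4/π²) ∑_{n ≥ 1} A_n / n`, the series converging almost surely
      -- (`A n` stands for `A_{n+1}`).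
      (∀ (Ω : Type*) [MeasurableSpace Ω] (P : Measure Ω) [IsProbabilityMeasure P]
        (A : ℕ → Ω → ℝ), iIndepFun A P → (∀ n, HasLaw (A n) sechLaw P) →
        ∃ S : Ω → ℝ,
          (∀ᵐ ω ∂P, Tendsto
            (fun N : ℕ => ∑ n ∈ Finset.range N, A n ω / ((n : ℝ) + 1)) atTop (𝓝 (S ω))) ∧
          HasLaw (fun ω => 4 / Real.pi ^ 2 * S ω) (W : Measure ℝ) P) ∧
      -- `W` is absolutely continuous with respect to Lebesgue measure.
      (W : Measure ℝ) ≪ volume ∧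
      -- `W ∼ (4/π²) ∑_{n ≥ 1} ∑_{m ≥ 1 odd} L_{mn} / (m n)`, an almost surely convergent
      -- iterated series (`L k n` stands for `L_{2k+1, n+1}`).
      (∀ (Ω : Type*) [MeasurableSpace Ω] (P : Measure Ω) [IsProbabilityMeasure P]
        (L : ℕ → ℕ → Ω → ℝ), iIndepFun (fun p : ℕ × ℕ => L p.1 p.2) P →
        (∀ k n, HasLaw (L k n) laplaceLaw P) →
        ∃ (T : ℕ → Ω → ℝ) (S : Ω → ℝ),
          (∀ᵐ ω ∂P, ∀ n : ℕ, Tendsto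
            (fun K : ℕ => ∑ k ∈ Finset.range K,
              L k n ω / ((2 * (k : ℝ) + 1) * ((n : ℝ) + 1))) atTop (𝓝 (T n ω))) ∧
          (∀ᵐ ω ∂P, Tendsto
            (fun N : ℕ => ∑ n ∈ Finset.range N, T n ω) atTop (𝓝 (S ω))) ∧
          HasLaw (fun ω => 4 / Real.pi ^ 2 * S ω) (W : Measure ℝ) P) ∧
      -- `W` is infinitely divisible.
      IsInfinitelyDivisible (W : Measure ℝ) := by
  refine ⟨existsUnique_hasWritheMGF, fun W hW => ⟨hW.hasProd_charFun, ?_, hW.absolutelyContinuous,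
    ?_, hW.isInfinitelyDivisible⟩⟩
  · intro Ω _ P _ A hA hlaw
    obtain ⟨S, hS, hlim, hM, -⟩ := exists_sech_series hA hlaw
    exact ⟨S, hlim, hW.hasLaw hS hM⟩
  · intro Ω _ P _ L hL hlaw
    exact hW.laplace_series hL hlaw
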